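/- Let $n\ge 1$, $N=\{1,\dots,n\}$, let $\chi_i$ be the $i$-th unit vector of $\mathbb{R}^n$, and let $f:\mathbb{R}^n\to\mathbb{R}\cup\{+\infty\}$ be a polyhedral M-convex function whose effective domain $\mathrm{dom}\,f=\{x: f(x)<+\infty\}$ is bounded; that is, the epigraph $\{(x,\alpha)\in\mathbb{R}^n\times\mathbb{R} : f(x)\le\alpha\}$ is a polyhedron, and for all $x,y\in\mathrm{dom}\,f$ and all $i$ with $x(i)>y(i)$ there are $j$ with $x(j)<y(j)$ and $\epsilon_0>0$ such that $$f(x)+f(y)\ \ge\ f(x-\epsilon(\chi_i-\chi_j))+f(y+\epsilon(\chi_i-\chi_j))\qquad(0\le\epsilon\le\epsilon_0).$$ For $x\in\mathrm{dom}\,f$ and $i,j\in N$ put $$f'(x;i,j)=\lim_{\alpha\downarrow 0}\frac{f(x+\alpha(\chi_i-\chi_j))-f(x)}{\alpha},\qquad \phi(x)=\min_{i,j\in N}f'(x;i,j),$$ $$\bar c(x;i,j)=\max\{\lambda\ge 0 : f(x+\lambda(\chi_i-\chi_j))-f(x)=\lambda f'(x;i,j)\}.$$ The long-step steepest descent algorithm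 PM-LSD2 starts with an arbitrary $x:=x_0\in\mathrm{dom}\,f$ and repeats the following: if $\phi(x)=0$, output $x$ and stop; otherwise replace $x$ by the output of PM-IncSlope$(x)$. The procedure PM-IncSlope$(x)$ sets $y:=x$ and takes the elements $i\in N$ one after another, in an arbitrary order; for each $i$ it takes the elements $j\in N\setminus\{i\}$ one after another, in an arbitrary order, and, whenever $f'(y;i,j)=\phi(x)$, it sets $y:=y+\bar c(y;i,j)(\chi_i-\chi_j)$. After all pairs have been treated it outputs $y$. Then, for every initial point $x_0\in\mathrm{dom}\,f$ and all choices made during its execution, PM-LSD2 can always proceed until it stops, it stops after finitely many iterations (for each $x_0$, the number of elementary steps is bounded over all choices), and its output is a global minimizer of $f$. -/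

import Mathlib

open Filter Topology

noncomputable section

namespace PolyM

/-- A polyhedron: the set of solutions of a finite system of (weak) linear inequalities. -/
def IsPolyhedron {E : Type*} [AddCommGroup E] [Module ℝ E] (S : Set E) : Prop :=
  ∃ T : Finset (Module.Dual ℝ E × ℝ), S = {z | ∀ p ∈ T, p.1 z ≤ p.2}

/-- The effective domain of an extended real valued function. -/
def dom {n : ℕ} (f : (Fin n → ℝ) → EReal) : Set (Fin n → ℝ) :=
  {x | f x < ⊤}

/-- The direction `χ i - χ j`, the difference of two unit vectors. -/
def dir {n : ℕ} (i j : Fin n) : Fin n → ℝ :=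
  Pi.single i 1 - Pi.single j 1

/-- A polyhedral convex function with values in `ℝ ∪ {+∞}`: the value `-∞` is not taken, and the
epigraph is a polyhedron. -/
structure IsPolyhedralConvex {n : ℕ} (f : (Fin n → ℝ) → EReal) : Prop where
  ne_bot : ∀ x, f x ≠ ⊥
  polyhedron : IsPolyhedron {p : (Fin n → ℝ) × ℝ | f p.1 ≤ (p.2 : EReal)}

/-- A polyhedral M-convex function: a polyhedral convex function with the exchange axiom. -/
structure IsPolyhedralMConvex {n : ℕ} (f : (Fin n → ℝ) → EReal) : Prop
    extends IsPolyhedralConvex f where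
  exchange : ∀ x ∈ dom f, ∀ y ∈ dom f, ∀ i : Fin n, y i < x i →
    ∃ j : Fin n, x j < y j ∧ ∃ ε₀ : ℝ, 0 < ε₀ ∧ ∀ ε : ℝ, 0 ≤ ε → ε ≤ ε₀ →
      f (x - ε • dir i j) + f (y + ε • dir i j) ≤ f x + f y

/-- The directional derivative of `f` at `x` in the direction `χ i - χ j`, a limit in the extended
reals (it is `+∞` if the direction leaves the effective domain immediately). -/
def dirDeriv {n : ℕ} (f : (Fin n → ℝ) → EReal) (x : Fin n → ℝ) (i j : Fin n) : EReal :=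
  limUnder (𝓝[>] (0 : ℝ)) (fun α : ℝ => (f (x + α • dir i j) - f x) / (α : EReal))

/-- The slope of a steepest descent direction at `x`: the minimum of the directional derivatives
over all pairs `i, j` (a minimum over a finite set, nonempty for `0 < n`). -/
def slope {n : ℕ} (f : (Fin n → ℝ) → EReal) (x : Fin n → ℝ) : EReal :=
  ⨅ (i : Fin n) (j : Fin n), dirDeriv f x i j

/-- `c` is the long step length at `x` in the direction `χ i - χ j`: the maximum of all `c ≥ 0`
such that `f` has constant slope `dirDeriv f x i j` on the step of length `c`. -/
def IsStepLength {n : ℕ} (f : (Fin n → ℝ) → EReal) (x : Fin n → ℝ) (i j : Fin n) (c : ℝ) : Prop :=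
  IsGreatest {c : ℝ | 0 ≤ c ∧ f (x + c • dir i j) - f x = (c : EReal) * dirDeriv f x i j} c

/-- Control states of the algorithm.
* `test x`: the main loop, about to test whether the slope at `x` is zero.
* `outer x y P`: inside the slope increasing procedure called with argument `x`, with current
  vector `y` and the set `P` of indices `i` still to be taken.
* `inner x y P i M`: as before, while the index `i ∈ P` is treated, with the set `M` of indices `j`
  still to be taken for this `i`.
* `output x`: the algorithm has stopped with output `x`. -/
inductive State (n : ℕ) : Type
  | test (x : Fin n → ℝ)
  | outer (x y : Fin n → ℝ) (P : Finset (Fin n))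
  | inner (x y : Fin n → ℝ) (P : Finset (Fin n)) (i : Fin n) (M : Finset (Fin n))
  | output (x : Fin n → ℝ)

/-- One elementary step of the algorithm; it is nondeterministic, since `i` and `j` are taken
arbitrarily from the remaining sets. -/
inductive Step {n : ℕ} (f : (Fin n → ℝ) → EReal) : State n → State n → Prop
  /-- The slope at `x` is zero: output `x` and stop. -/
  | finish (x : Fin n → ℝ) (h : slope f x = 0) : Step f (.test x) (.output x)
  /-- The slope at `x` is not zero: call the slope increasing procedure on `x`. -/
  | call (x : Fin n → ℝ) (h : slope f x ≠ 0) : Step f (.test x) (.outer x x Finset.univ)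
  /-- Take any remaining `i`, and start with all `j ≠ i`. -/
  | takeOuter (x y : Fin n → ℝ) (P : Finset (Fin n)) (i : Fin n) (hi : i ∈ P) :
      Step f (.outer x y P) (.inner x y P i (Finset.univ.erase i))
  /-- Take any remaining `j`; the derivative is the slope at `x`, so make a long step. -/
  | move (x y : Fin n → ℝ) (P : Finset (Fin n)) (i : Fin n) (M : Finset (Fin n)) (j : Fin n)
      (hj : j ∈ M) (h : dirDeriv f y i j = slope f x) (c : ℝ) (hc : IsStepLength f y i j c) :
      Step f (.inner x y P i M) (.inner x (y + c • dir i j) P i (M.erase j))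
  /-- Take any remaining `j`; the derivative is not the slope at `x`, so do not move. -/
  | skip (x y : Fin n → ℝ) (P : Finset (Fin n)) (i : Fin n) (M : Finset (Fin n)) (j : Fin n)
      (hj : j ∈ M) (h : dirDeriv f y i j ≠ slope f x) :
      Step f (.inner x y P i M) (.inner x y P i (M.erase j))
  /-- All `j` are treated: `i` is done. -/
  | closeInner (x y : Fin n → ℝ) (P : Finset (Fin n)) (i : Fin n) :
      Step f (.inner x y P i ∅) (.outer x y (P.erase i))
  /-- All `i` are treated: the procedure returns `y` to the main loop. -/
  | ret (x y : Fin n → ℝ) : Step f (.outer x y ∅) (.test y)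

end PolyM

end

/-!
The argument is elementary once `f` is understood along the directions `χ i - χ j`. Because the
epigraph is a polyhedron, `f` is affine for a short while along every such direction, with a slope
from a finite set `V` which does not depend on the point, unless the direction leaves the domain at
once; on the whole ray `f` lies above this affine function (`dirDeriv_cases`). So slopes take only
finitely many values, and long step lengths exist when the domain is bounded.

The exchange axiom enters through one estimate: if no directional derivative at `x` is below `s`,
then `f z ≥ f x + s ‖z - x‖₁ / 2` for all `z` (`IsPolyhedralMConvex.le_of_le_dirDeriv`). With
`s = 0` it says that a point of slope zero is a global minimizer. When the estimate is tight at
`z`, every exchange between `z` and `x` uses a direction whose derivative at `x` is at most `s`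
(`Exchangeable.dirDeriv_le`).

Let `s < 0` be the slope at the argument of the slope increasing procedure, and consider a step
along a direction of derivative `s`. By the estimate no directional derivative falls below `s`
(`le_dirDeriv_of_step`). If some `(i, j)` has derivative `s` after the step, then the estimate is
tight at the point reached by the step followed by a small step along `(i, j)`, and the exchange
axiom yields a direction which had derivative `s` before. This shows that an index `i` all of whose
directions have derivatives above `s` keeps this property (`lt_dirDeriv_of_step`), and that a
direction `(i, j)` with derivative above `s` keeps it while other directions `(i, k)` of the same
index are treated (`lt_dirDeriv_of_step_same`). The direction of the step itself gets a derivative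
above `s` because the step is as long as possible (`lt_dirDeriv_of_isStepLength`). Hence, when the
procedure ends, all directional derivatives are above `s`: each call strictly increases the slope,
and since the slope lies in `V` the number of calls is bounded.
-/

noncomputable section

namespace PolyM

variable {n : ℕ} {f : (Fin n → ℝ) → EReal}

/-! ### Polyhedral convex functions -/

theorem mem_dom_of_ne_top {x : Fin n → ℝ} (h : f x ≠ ⊤) : x ∈ dom f :=
  lt_top_iff_ne_top.2 h

theorem exists_real_of_mem_dom (hf : IsPolyhedralConvex f) {x : Fin n → ℝ} (hx : x ∈ dom f) :
    ∃ v : ℝ, f x = v := by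
  have h1 : f x ≠ ⊤ := ne_of_lt hx
  exact ⟨(f x).toReal, (EReal.coe_toReal h1 (hf.ne_bot x)).symm⟩

theorem mem_dom_of_le {x : Fin n → ℝ} {v : ℝ} (h : f x ≤ v) : x ∈ dom f :=
  lt_of_le_of_lt h (EReal.coe_lt_top v)

theorem exists_real_le_of_le (hf : IsPolyhedralConvex f) {x : Fin n → ℝ} {v : ℝ} (h : f x ≤ v) :
    ∃ u : ℝ, f x = u ∧ u ≤ v := by
  obtain ⟨u, hu⟩ := exists_real_of_mem_dom hf (mem_dom_of_le h)
  exact ⟨u, hu, by rw [hu] at h; exact_mod_cast h⟩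

theorem IsPolyhedralConvex.isClosed_le (hf : IsPolyhedralConvex f) {X : Type*} [TopologicalSpace X]
    {g : X → Fin n → ℝ} {h : X → ℝ} (hg : Continuous g) (hh : Continuous h) :
    IsClosed {z | f (g z) ≤ (h z : EReal)} := by
  obtain ⟨T, hT⟩ := hf.polyhedron
  have hc : IsClosed {p : (Fin n → ℝ) × ℝ | f p.1 ≤ (p.2 : EReal)} := by
    rw [hT]
    simp only [Set.ofPred_forall]
    refine isClosed_biInter fun p _ => _root_.isClosed_le ?_ continuous_const
    exact p.1.continuous_of_finiteDimensional
  exact hc.preimage (hg.prodMk hh)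

/-- Along `d` the constraints of the epigraph that are active at `(x, f x)` decide what happens. An
active constraint not involving the last coordinate may forbid leaving `x` along `d`; otherwise the
initial slope is the largest of the slopes of the remaining active constraints. The set `V` of
slopes of all constraints depends on `d` only. -/
theorem exists_local_slopes (hf : IsPolyhedralConvex f) (d : Fin n → ℝ) :
    ∃ V : Finset ℝ, ∀ (x : Fin n → ℝ) (v : ℝ), f x = v →
      (∃ m ∈ V, (∀ α : ℝ, 0 ≤ α → ((v + α * m : ℝ) : EReal) ≤ f (x + α • d)) ∧
        ∃ α₀ : ℝ, 0 < α₀ ∧ ∀ α : ℝ, 0 ≤ α → α ≤ α₀ → f (x + α • d) ≤ ((v + α * m : ℝ) : EReal)) ∨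
      ∀ α : ℝ, 0 < α → f (x + α • d) = ⊤ := by
  classical
  obtain ⟨T, hT⟩ := hf.polyhedron
  have mem : ∀ (x : Fin n → ℝ) (t : ℝ), f x ≤ t ↔ ∀ p ∈ T, p.1 (x, t) ≤ p.2 := fun x t =>
    Set.ext_iff.1 hT (x, t)
  refine ⟨T.image fun p => p.1 (d, 0) / -p.1 (0, 1), fun x v hv => ?_⟩
  have expand : ∀ (p : Module.Dual ℝ ((Fin n → ℝ) × ℝ) × ℝ) (α r : ℝ),
      p.1 (x + α • d, v + r) = p.1 (x, v) + α * p.1 (d, 0) + r * p.1 (0, 1) := by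
    intro p α r
    have : ((x + α • d, v + r) : (Fin n → ℝ) × ℝ) = (x, v) + α • (d, 0) + r • (0, 1) := by
      ext <;> simp
    rw [this, map_add, map_add, map_smul, map_smul, smul_eq_mul, smul_eq_mul]
  have hxv := (mem x v).1 hv.le
  -- The epigraph is closed under increasing the last coordinate.
  have hb : ∀ p ∈ T, p.1 (0, 1) ≤ 0 := by
    intro p hp
    by_contra! hpos
    have hr : 0 ≤ (p.2 - p.1 (x, v) + 1) / p.1 (0, 1) :=
      div_nonneg (by linarith [hxv p hp]) hpos.le
    have h1 := (mem x (v + (p.2 - p.1 (x, v) + 1) / p.1 (0, 1))).1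
      (hv.le.trans (by exact_mod_cast le_add_of_nonneg_right hr)) p hp
    have h2 := expand p 0 ((p.2 - p.1 (x, v) + 1) / p.1 (0, 1))
    rw [zero_smul, add_zero, div_mul_cancel₀ _ hpos.ne'] at h2
    linarith
  by_cases hvert : ∃ p ∈ T, p.1 (x, v) = p.2 ∧ p.1 (0, 1) = 0 ∧ 0 < p.1 (d, 0)
  · right
    obtain ⟨p, hp, hact, hzero, hpos⟩ := hvert
    intro α hα
    by_contra hne
    obtain ⟨u, hu⟩ := exists_real_of_mem_dom hf (mem_dom_of_ne_top hne)
    have h1 := (mem _ _).1 hu.le p hp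
    have h2 := expand p α (u - v)
    rw [add_sub_cancel, hzero] at h2
    nlinarith [mul_pos hα hpos]
  · left
    push Not at hvert
    have hne : (T.filter fun p => p.1 (x, v) = p.2 ∧ p.1 (0, 1) < 0).Nonempty := by
      by_contra hemp
      rw [Finset.not_nonempty_iff_eq_empty, Finset.filter_eq_empty_iff] at hemp
      -- Otherwise the value at `x` could be decreased.
      have hev : ∀ᶠ r : ℝ in 𝓝[>] 0, ∀ p ∈ T, p.1 (x, v) + (-r) * p.1 (0, 1) ≤ p.2 := by
        rw [Filter.eventually_all_finset]
        intro p hp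
        rcases (hxv p hp).lt_or_eq with hlt | heq
        · have hcont : Tendsto (fun r : ℝ => p.1 (x, v) + (-r) * p.1 (0, 1)) (𝓝[>] 0)
              (𝓝 (p.1 (x, v) + (-0) * p.1 (0, 1))) :=
            (Continuous.tendsto (by fun_prop) 0).mono_left nhdsWithin_le_nhds
          rw [neg_zero, zero_mul, add_zero] at hcont
          exact (hcont.eventually_lt_const hlt).mono fun _ h => h.le
        · have h0 : p.1 (0, 1) = 0 := by
            by_contra h0
            exact hemp hp ⟨heq, lt_of_le_of_ne (hb p hp) h0⟩
          exact Eventually.of_forall fun r => by rw [h0, mul_zero, add_zero]; exact heq.le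
      obtain ⟨r, hr, hr0⟩ := (hev.and self_mem_nhdsWithin).exists
      have hle : f x ≤ ((v + -r : ℝ) : EReal) := (mem _ _).2 fun p hp => by
        have h2 := expand p 0 (-r)
        rw [zero_smul, add_zero, zero_mul, add_zero] at h2
        rw [h2]
        exact hr p hp
      rw [hv, EReal.coe_le_coe_iff] at hle
      have : (0 : ℝ) < r := hr0
      linarith
    obtain ⟨q, hq, hmax⟩ := Finset.exists_max_image _
      (fun p : Module.Dual ℝ ((Fin n → ℝ) × ℝ) × ℝ => p.1 (d, 0) / -p.1 (0, 1)) hne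
    rw [Finset.mem_filter] at hq
    obtain ⟨hqT, hqact, hqneg⟩ := hq
    set m := q.1 (d, 0) / -q.1 (0, 1) with hm
    have hqm : q.1 (d, 0) = m * -q.1 (0, 1) := by
      rw [hm, div_mul_cancel₀ _ (by linarith)]
    refine ⟨m, Finset.mem_image_of_mem _ hqT, ?_, ?_⟩
    · intro α hα
      by_contra! hlt
      obtain ⟨u, hu⟩ := exists_real_of_mem_dom hf (hlt.trans (EReal.coe_lt_top _))
      have h1 := (mem _ _).1 hu.le q hqT
      have h2 := expand q α (u - v)
      rw [hu, EReal.coe_lt_coe_iff] at hlt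
      rw [add_sub_cancel, hqm, hqact] at h2
      nlinarith
    · -- Inactive constraints stay satisfied by continuity, active ones by the choice of `m`.
      have hev : ∀ᶠ α : ℝ in 𝓝[≥] 0, ∀ p ∈ T,
          p.1 (x, v) + α * p.1 (d, 0) + (α * m) * p.1 (0, 1) ≤ p.2 := by
        rw [Filter.eventually_all_finset]
        intro p hp
        rcases (hxv p hp).lt_or_eq with hlt | heq
        · have hcont : Tendsto (fun α : ℝ => p.1 (x, v) + α * p.1 (d, 0) + (α * m) * p.1 (0, 1))
              (𝓝[≥] 0) (𝓝 (p.1 (x, v) + 0 * p.1 (d, 0) + (0 * m) * p.1 (0, 1))) :=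
            (Continuous.tendsto (by fun_prop) 0).mono_left nhdsWithin_le_nhds
          simp only [zero_mul, add_zero] at hcont
          exact (hcont.eventually_lt_const hlt).mono fun _ h => h.le
        · filter_upwards [self_mem_nhdsWithin] with α hα
          have hα : (0 : ℝ) ≤ α := hα
          rcases (hb p hp).lt_or_eq with hneg | h0
          · have h3 := hmax p (Finset.mem_filter.2 ⟨hp, heq, hneg⟩)
            rw [div_le_iff₀ (by linarith)] at h3
            have := mul_le_mul_of_nonneg_left h3 hα
            linarith
          · have := mul_nonpos_of_nonneg_of_nonpos hα (hvert p hp heq h0)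
            rw [h0]
            linarith
      obtain ⟨α₀, hα₀, hsub⟩ := (nhdsGE_basis (0 : ℝ)).mem_iff.1 hev
      refine ⟨α₀ / 2, half_pos hα₀, fun α h0 h1 => (mem _ _).2 fun p hp => ?_⟩
      rw [expand]
      exact hsub (show α ∈ Set.Ico 0 α₀ from ⟨h0, by linarith⟩) p hp

/-! ### Directional derivatives -/

theorem dirDeriv_eq_coe {x : Fin n → ℝ} {i j : Fin n} {v m α₀ : ℝ} (hv : f x = v) (hα₀ : 0 < α₀)
    (h : ∀ α : ℝ, 0 ≤ α → α ≤ α₀ → f (x + α • dir i j) = ((v + α * m : ℝ) : EReal)) :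
    dirDeriv f x i j = m := by
  refine Tendsto.limUnder_eq (tendsto_const_nhds.congr' ?_)
  filter_upwards [Ioc_mem_nhdsGT hα₀] with α hα
  rw [h α hα.1.le hα.2, hv, ← EReal.coe_sub, ← EReal.coe_div, add_sub_cancel_left,
    mul_div_cancel_left₀ _ hα.1.ne']

theorem dirDeriv_eq_top {x : Fin n → ℝ} {i j : Fin n} {v : ℝ} (hv : f x = v)
    (h : ∀ α : ℝ, 0 < α → f (x + α • dir i j) = ⊤) :
    dirDeriv f x i j = ⊤ := by
  refine Tendsto.limUnder_eq (tendsto_const_nhds.congr' ?_)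
  filter_upwards [self_mem_nhdsWithin] with α hα
  have hα : (0 : ℝ) < α := hα
  rw [h α hα, hv, EReal.top_sub_coe, EReal.top_div_of_pos_ne_top]
  · exact_mod_cast hα
  · exact EReal.coe_ne_top α

/-- The directional derivative `m` is finite, attained on a short segment and a lower bound on the
whole ray, or the ray leaves the domain at once. The set `V` does not depend on the point. -/
theorem dirDeriv_cases (hf : IsPolyhedralConvex f) (i j : Fin n) :
    ∃ V : Finset ℝ, ∀ (x : Fin n → ℝ) (v : ℝ), f x = v →
      (∃ m ∈ V, dirDeriv f x i j = m ∧
        (∀ α : ℝ, 0 ≤ α → ((v + α * m : ℝ) : EReal) ≤ f (x + α • dir i j)) ∧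
        ∃ α₀ : ℝ, 0 < α₀ ∧ ∀ α : ℝ, 0 ≤ α → α ≤ α₀ →
          f (x + α • dir i j) = ((v + α * m : ℝ) : EReal)) ∨
      dirDeriv f x i j = ⊤ ∧ ∀ α : ℝ, 0 < α → f (x + α • dir i j) = ⊤ := by
  obtain ⟨V, hV⟩ := exists_local_slopes hf (dir i j)
  refine ⟨V, fun x v hv => ?_⟩
  rcases hV x v hv with ⟨m, hm, h1, α₀, hα₀, h2⟩ | h
  · have h3 : ∀ α : ℝ, 0 ≤ α → α ≤ α₀ →
        f (x + α • dir i j) = ((v + α * m : ℝ) : EReal) :=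
      fun α ha hb => le_antisymm (h2 α ha hb) (h1 α ha)
    exact Or.inl ⟨m, hm, dirDeriv_eq_coe hv hα₀ h3, h1, α₀, hα₀, h3⟩
  · exact Or.inr ⟨dirDeriv_eq_top hv h, h⟩

theorem le_of_le_dirDeriv (hf : IsPolyhedralConvex f) {x : Fin n → ℝ} {i j : Fin n} {v s α : ℝ}
    (hv : f x = v) (hs : (s : EReal) ≤ dirDeriv f x i j) (hα : 0 ≤ α) :
    ((v + α * s : ℝ) : EReal) ≤ f (x + α • dir i j) := by
  obtain ⟨V, hV⟩ := dirDeriv_cases hf i j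
  rcases hV x v hv with ⟨m, -, hm, h1, -⟩ | ⟨-, h⟩
  · rw [hm, EReal.coe_le_coe_iff] at hs
    refine le_trans ?_ (h1 α hα)
    have := mul_le_mul_of_nonneg_left hs hα
    exact_mod_cast (by linarith)
  · rcases hα.eq_or_lt with rfl | hpos
    · simp [hv]
    · rw [h α hpos]
      exact le_top

theorem dirDeriv_le_of_le (hf : IsPolyhedralConvex f) {x : Fin n → ℝ} {i j : Fin n} {v s α : ℝ}
    (hv : f x = v) (hα : 0 < α) (h : f (x + α • dir i j) ≤ ((v + α * s : ℝ) : EReal)) :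
    dirDeriv f x i j ≤ s := by
  obtain ⟨V, hV⟩ := dirDeriv_cases hf i j
  rcases hV x v hv with ⟨m, -, hm, h1, -⟩ | ⟨-, h1⟩
  · rw [hm, EReal.coe_le_coe_iff]
    have h2 := (h1 α hα.le).trans h
    rw [EReal.coe_le_coe_iff] at h2
    exact le_of_mul_le_mul_left (by linarith) hα
  · rw [h1 α hα] at h
    exact absurd (top_le_iff.1 h) (EReal.coe_ne_top _)

theorem exists_eq_of_dirDeriv_eq (hf : IsPolyhedralConvex f) {x : Fin n → ℝ} {i j : Fin n}
    {v s : ℝ} (hv : f x = v) (hs : dirDeriv f x i j = s) :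
    ∃ α₀ : ℝ, 0 < α₀ ∧ ∀ α : ℝ, 0 ≤ α → α ≤ α₀ →
      f (x + α • dir i j) = ((v + α * s : ℝ) : EReal) := by
  obtain ⟨V, hV⟩ := dirDeriv_cases hf i j
  rcases hV x v hv with ⟨m, -, hm, -, h⟩ | ⟨h, -⟩
  · rw [hm, EReal.coe_eq_coe_iff] at hs
    rwa [← hs]
  · rw [h] at hs
    exact absurd hs.symm (EReal.coe_ne_top _)

theorem dirDeriv_self (hf : IsPolyhedralConvex f) {x : Fin n → ℝ} (hx : x ∈ dom f) (i : Fin n) :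
    dirDeriv f x i i = 0 := by
  obtain ⟨v, hv⟩ := exists_real_of_mem_dom hf hx
  exact dirDeriv_eq_coe (m := 0) hv one_pos fun α _ _ => by simp [dir, hv]

/-! ### The slope -/

theorem slope_le (x : Fin n → ℝ) (i j : Fin n) : slope f x ≤ dirDeriv f x i j := by
  unfold slope
  exact (iInf_le _ i).trans (iInf_le _ j)

theorem exists_slope_eq (hn : 0 < n) (x : Fin n → ℝ) : ∃ i j, dirDeriv f x i j = slope f x := by
  have : Nonempty (Fin n) := ⟨⟨0, hn⟩⟩
  obtain ⟨i, hi⟩ := exists_eq_ciInf_of_finite (f := fun i => ⨅ j, dirDeriv f x i j)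
  obtain ⟨j, hj⟩ := exists_eq_ciInf_of_finite (f := fun j => dirDeriv f x i j)
  exact ⟨i, j, hj.trans hi⟩

theorem slope_nonpos (hn : 0 < n) (hf : IsPolyhedralConvex f) {x : Fin n → ℝ} (hx : x ∈ dom f) :
    slope f x ≤ 0 :=
  (slope_le x ⟨0, hn⟩ ⟨0, hn⟩).trans_eq (dirDeriv_self hf hx _)

theorem exists_slope_values (hn : 0 < n) (hf : IsPolyhedralConvex f) :
    ∃ V : Finset ℝ, ∀ x ∈ dom f, ∃ s ∈ V, slope f x = (s : EReal) := by
  classical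
  choose V hV using fun i j => dirDeriv_cases hf i j
  refine ⟨Finset.univ.biUnion fun i => Finset.univ.biUnion fun j => V i j, fun x hx => ?_⟩
  obtain ⟨v, hv⟩ := exists_real_of_mem_dom hf hx
  obtain ⟨i, j, hij⟩ := exists_slope_eq (f := f) hn x
  rcases hV i j x v hv with ⟨m, hm, h, -⟩ | ⟨h, -⟩
  · refine ⟨m, ?_, hij ▸ h⟩
    simp only [Finset.mem_biUnion, Finset.mem_univ, true_and]
    exact ⟨i, j, hm⟩
  · have := slope_nonpos hn hf hx
    rw [← hij, h] at this
    exact absurd this (by simp)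

/-! ### The ℓ¹ norm and exchange directions -/

/-- The `ℓ¹` norm on `Fin n → ℝ`, whose own norm is the sup norm. -/
def l1 (z : Fin n → ℝ) : ℝ :=
  ∑ k, |z k|

theorem continuous_l1 : Continuous (l1 : (Fin n → ℝ) → ℝ) := by
  unfold l1
  fun_prop

theorem l1_add_le (z w : Fin n → ℝ) : l1 (z + w) ≤ l1 z + l1 w := by
  unfold l1
  rw [← Finset.sum_add_distrib]
  exact Finset.sum_le_sum fun k _ => abs_add_le _ _

theorem l1_smul_dir_le (i j : Fin n) {a : ℝ} (ha : 0 ≤ a) : l1 (a • dir i j) ≤ 2 * a := by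
  have h : ∀ k, |(a • dir i j) k| ≤ a * Pi.single (M := fun _ => ℝ) i 1 k
      + a * Pi.single (M := fun _ => ℝ) j 1 k := by
    intro k
    simp only [dir, Pi.smul_apply, Pi.sub_apply, smul_eq_mul, Pi.single_apply]
    split_ifs <;> simp [abs_of_nonneg ha, ha]
  refine (Finset.sum_le_sum fun k _ => h k).trans_eq ?_
  rw [Finset.sum_add_distrib, ← Finset.mul_sum, ← Finset.mul_sum]
  simp
  ring

theorem l1_sub_smul_dir {w : Fin n → ℝ} {i j : Fin n} {ε : ℝ} (hε : 0 < ε) (hi : ε ≤ w i)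
    (hj : w j ≤ -ε) : l1 (w - ε • dir i j) = l1 w - 2 * ε := by
  have hij : i ≠ j := by
    rintro rfl
    linarith
  have h : ∀ k, |(w - ε • dir i j) k| = |w k| - (ε * Pi.single (M := fun _ => ℝ) i 1 k
      + ε * Pi.single (M := fun _ => ℝ) j 1 k) := by
    intro k
    simp only [dir, Pi.smul_apply, Pi.sub_apply, smul_eq_mul, Pi.single_apply]
    by_cases hki : k = i
    · subst hki
      rw [if_pos rfl, if_neg hij, abs_of_nonneg (by linarith), abs_of_nonneg (by linarith)]
      ring
    · by_cases hkj : k = j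
      · subst hkj
        rw [if_pos rfl, if_neg hki, abs_of_nonpos (by linarith), abs_of_nonpos (by linarith)]
        ring
      · rw [if_neg hki, if_neg hkj]
        simp
  unfold l1
  rw [Finset.sum_congr rfl fun k _ => h k, Finset.sum_sub_distrib, Finset.sum_add_distrib,
    ← Finset.mul_sum, ← Finset.mul_sum]
  simp
  ring

theorem dir_swap (i j : Fin n) : dir j i = -dir i j := by
  simp [dir]

/-! ### The exchange axiom in real form -/

theorem exists_real_of_add_le (hf : IsPolyhedralConvex f) {a b : Fin n → ℝ} {c : ℝ}
    (h : f a + f b ≤ c) : ∃ u v : ℝ, f a = u ∧ f b = v ∧ u + v ≤ c := by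
  have ha : a ∈ dom f := by
    refine mem_dom_of_ne_top fun ht => ?_
    rw [ht, EReal.top_add_of_ne_bot (hf.ne_bot b)] at h
    exact EReal.coe_ne_top c (top_le_iff.1 h)
  have hb : b ∈ dom f := by
    refine mem_dom_of_ne_top fun ht => ?_
    rw [ht, EReal.add_top_of_ne_bot (hf.ne_bot a)] at h
    exact EReal.coe_ne_top c (top_le_iff.1 h)
  obtain ⟨u, hu⟩ := exists_real_of_mem_dom hf ha
  obtain ⟨v, hv⟩ := exists_real_of_mem_dom hf hb
  rw [hu, hv] at h
  exact ⟨u, v, hu, hv, by exact_mod_cast h⟩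

/-- An exchange between `y`, of value `v`, and `z`, of value `w`: moving `z` towards
`y` and `y` towards `z` along `dir i j` by `ε` overshoots in neither of the coordinates `i`, `j`
and does not increase the sum of the two values. -/
def Exchangeable (f : (Fin n → ℝ) → EReal) (y z : Fin n → ℝ) (v w : ℝ) (i j : Fin n) (ε : ℝ) :
    Prop :=
  0 < ε ∧ ε ≤ z i - y i ∧ ε ≤ y j - z j ∧ ∃ w' v' : ℝ, f (z - ε • dir i j) = w' ∧
    f (y + ε • dir i j) = v' ∧ w' + v' ≤ w + v

theorem IsPolyhedralMConvex.exists_exchange (hf : IsPolyhedralMConvex f) {y z : Fin n → ℝ}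
    {v w : ℝ} (hv : f y = v) (hw : f z = w) {i : Fin n} (hi : y i < z i) :
    ∃ j ε, Exchangeable f y z v w i j ε := by
  obtain ⟨j, hj, ε₀, hε₀, h⟩ := hf.exchange z (mem_dom_of_le hw.le) y (mem_dom_of_le hv.le) i hi
  have hε : 0 < min ε₀ (min (z i - y i) (y j - z j)) :=
    lt_min hε₀ (lt_min (by linarith) (by linarith))
  refine ⟨j, _, hε, (min_le_right _ _).trans (min_le_left _ _),
    (min_le_right _ _).trans (min_le_right _ _), ?_⟩
  have h1 := h _ hε.le (min_le_left _ _)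
  rw [hv, hw, ← EReal.coe_add] at h1
  exact exists_real_of_add_le hf.toIsPolyhedralConvex h1

/-- The exchange property starting from a coordinate to be increased in `z`. -/
theorem IsPolyhedralMConvex.exists_exchange' (hf : IsPolyhedralMConvex f) {y z : Fin n → ℝ}
    {v w : ℝ} (hv : f y = v) (hw : f z = w) {j : Fin n} (hj : z j < y j) :
    ∃ i ε, Exchangeable f y z v w i j ε := by
  obtain ⟨i, ε, hε, h1, h2, v', w', hv', hw', h⟩ := hf.exists_exchange hw hv hj
  rw [dir_swap, smul_neg, sub_neg_eq_add] at hv'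
  rw [dir_swap, smul_neg, ← sub_eq_add_neg] at hw'
  exact ⟨i, ε, hε, h2, h1, w', v', hw', hv', by linarith⟩

theorem Exchangeable.l1_eq {y z : Fin n → ℝ} {v w : ℝ} {i j : Fin n} {ε : ℝ}
    (h : Exchangeable f y z v w i j ε) : l1 (z - ε • dir i j - y) = l1 (z - y) - 2 * ε := by
  rw [sub_right_comm]
  exact l1_sub_smul_dir h.1 h.2.1 (by linarith [h.2.2.1, Pi.sub_apply z y j])

/-- The growth estimate: a lower bound on the directional derivatives at `x` bounds `f` globally.
The points no farther from `x` than `z` that satisfy the bound with at most the slack of `z` form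
a compact set; the one closest to `x` in the `ℓ¹` norm is `x` itself, since otherwise an exchange
with `x` would bring it closer without leaving the set. -/
theorem IsPolyhedralMConvex.le_of_le_dirDeriv (hf : IsPolyhedralMConvex f) {x z : Fin n → ℝ}
    {v w s : ℝ} (hv : f x = v) (hs : ∀ i j, (s : EReal) ≤ dirDeriv f x i j) (hw : f z = w) :
    v + s * (l1 (z - x) / 2) ≤ w := by
  have hfc := hf.toIsPolyhedralConvex
  let h : (Fin n → ℝ) → ℝ := fun u => w + s * (l1 (u - x) / 2) - s * (l1 (z - x) / 2)
  have hlc : Continuous fun u : Fin n → ℝ => l1 (u - x) :=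
    continuous_l1.comp (continuous_id.sub continuous_const)
  have hclosed : IsClosed ({u | f u ≤ (h u : EReal)} ∩ {u | l1 (u - x) ≤ l1 (z - x)}) :=
    (hfc.isClosed_le continuous_id (by fun_prop)).inter
      (isClosed_le hlc continuous_const)
  have hbdd : Bornology.IsBounded
      ({u | f u ≤ (h u : EReal)} ∩ {u | l1 (u - x) ≤ l1 (z - x)}) := by
    refine (Metric.isBounded_closedBall (x := x) (r := l1 (z - x))).subset fun u hu => ?_
    have hnn : 0 ≤ l1 (z - x) := Finset.sum_nonneg fun _ _ => abs_nonneg _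
    rw [Metric.mem_closedBall, dist_pi_le_iff hnn]
    intro k
    refine le_trans ?_ hu.2
    exact Finset.single_le_sum (f := fun k => |(u - x) k|) (fun _ _ => abs_nonneg _)
      (Finset.mem_univ k)
  have hcompact := Metric.isCompact_of_isClosed_isBounded hclosed hbdd
  have hz : z ∈ {u | f u ≤ (h u : EReal)} ∩ {u | l1 (u - x) ≤ l1 (z - x)} :=
    ⟨by simp only [Set.mem_ofPred_eq, h, hw, add_sub_cancel_right, le_refl], le_refl (l1 (z - x))⟩
  obtain ⟨u, ⟨hu1, hu2⟩, hmin⟩ := hcompact.exists_isMinOn ⟨z, hz⟩ hlc.continuousOn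
  obtain ⟨t, ht, hth⟩ := exists_real_le_of_le hfc hu1
  have key : ¬ ∃ i j ε, Exchangeable f x u v t i j ε := by
    rintro ⟨i, j, ε, hex⟩
    have hl := hex.l1_eq
    obtain ⟨hε, -, -, t', v', ht', hv', hsum⟩ := hex
    have h1 := PolyM.le_of_le_dirDeriv hfc hv (hs i j) hε.le
    rw [hv', EReal.coe_le_coe_iff] at h1
    have h2 := hmin (a := u - ε • dir i j) ⟨by
      simp only [Set.mem_ofPred_eq, ht', h, EReal.coe_le_coe_iff, hl]
      simp only [h] at hth
      linarith, by
      simp only [Set.mem_ofPred_eq, hl] at hu2 ⊢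
      linarith⟩
    simp only [Set.mem_ofPred_eq, hl] at h2
    linarith
  have hux : u = x := by
    ext k
    refine le_antisymm (not_lt.1 fun hk => key ?_) (not_lt.1 fun hk => key ?_)
    · obtain ⟨j, ε, hex⟩ := hf.exists_exchange hv ht hk
      exact ⟨k, j, ε, hex⟩
    · obtain ⟨i, ε, hex⟩ := hf.exists_exchange' hv ht hk
      exact ⟨i, k, ε, hex⟩
  have hvt : v = t := by
    rw [hux, hv] at ht
    exact_mod_cast ht
  have h0 : l1 (u - x) = 0 := by simp [hux, l1]
  simp only [h, h0] at hth
  linarith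

/-- If the growth estimate from `y` is tight at `z`, it is not improved by an exchange, so the
point that `y` moves to has relative value at most `s`. -/
theorem Exchangeable.dirDeriv_le (hf : IsPolyhedralMConvex f) {y z : Fin n → ℝ} {v w s : ℝ}
    {i j : Fin n} {ε : ℝ} (hex : Exchangeable f y z v w i j ε) (hv : f y = v)
    (hs : ∀ i j, (s : EReal) ≤ dirDeriv f y i j) (hw : w ≤ v + s * (l1 (z - y) / 2)) :
    dirDeriv f y i j ≤ s := by
  have hl := hex.l1_eq
  obtain ⟨hε, -, -, w', v', hw', hv', hsum⟩ := hex
  have h1 := hf.le_of_le_dirDeriv hv hs hw'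
  rw [hl] at h1
  refine dirDeriv_le_of_le hf.toIsPolyhedralConvex hv hε ?_
  rw [hv', EReal.coe_le_coe_iff]
  linarith

/-! ### Steps along steepest descent directions -/

/-- A step of slope `s` keeps all directional derivatives at least `s`: a further short step along
`(i, j)` is controlled by the growth estimate from the starting point. -/
theorem le_dirDeriv_of_step (hf : IsPolyhedralMConvex f) {y : Fin n → ℝ} {v s c : ℝ}
    {h k : Fin n} (hs0 : s ≤ 0) (hc : 0 ≤ c) (hv : f y = v)
    (hs : ∀ i j, (s : EReal) ≤ dirDeriv f y i j)
    (hy' : f (y + c • dir h k) = ((v + c * s : ℝ) : EReal)) (i j : Fin n) :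
    (s : EReal) ≤ dirDeriv f (y + c • dir h k) i j := by
  have hfc := hf.toIsPolyhedralConvex
  obtain ⟨V, hV⟩ := dirDeriv_cases hfc i j
  rcases hV _ _ hy' with ⟨m, -, hm, -, δ, hδ, h1⟩ | ⟨ht, -⟩
  · have h2 := hf.le_of_le_dirDeriv hv hs (h1 δ hδ.le le_rfl)
    have h3 : l1 (y + c • dir h k + δ • dir i j - y) ≤ 2 * c + 2 * δ := by
      rw [add_assoc, add_sub_cancel_left]
      exact (l1_add_le _ _).trans (add_le_add (l1_smul_dir_le h k hc) (l1_smul_dir_le i j hδ.le))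
    rw [hm, EReal.coe_le_coe_iff]
    refine le_of_mul_le_mul_left ?_ hδ
    nlinarith
  · rw [ht]
    exact le_top

/-- If `(h, k)` and, after a step along it, `(i, j)` are descent directions with the same lowest
slope `s`, then the growth estimate is tight after both steps. Moreover `i ≠ k`, since otherwise the
two steps could be shortened to a path that descends faster than the estimate allows. -/
theorem exists_tight_of_step (hf : IsPolyhedralMConvex f) {y : Fin n → ℝ} {v s c : ℝ}
    {h k : Fin n} (hs0 : s < 0) (hc : 0 < c) (hv : f y = v)
    (hs : ∀ i j, (s : EReal) ≤ dirDeriv f y i j)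
    (hy' : f (y + c • dir h k) = ((v + c * s : ℝ) : EReal)) {i j : Fin n}
    (hij : dirDeriv f (y + c • dir h k) i j = s) :
    i ≠ k ∧ ∃ δ w : ℝ, 0 < δ ∧ f (y + c • dir h k + δ • dir i j) = w ∧
      w ≤ v + s * (l1 (y + c • dir h k + δ • dir i j - y) / 2) := by
  have hfc := hf.toIsPolyhedralConvex
  obtain ⟨δ₀, hδ₀, h1⟩ := exists_eq_of_dirDeriv_eq hfc hy' hij
  have hδ : 0 < min δ₀ c := lt_min hδ₀ hc
  have h2 := h1 _ hδ.le (min_le_left _ _)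
  set δ := min δ₀ c with hδdef
  have hδc : δ ≤ c := min_le_right _ _
  have hl : l1 (y + c • dir h k + δ • dir i j - y) ≤ 2 * c + 2 * δ := by
    rw [add_assoc, add_sub_cancel_left]
    exact (l1_add_le _ _).trans (add_le_add (l1_smul_dir_le h k hc.le) (l1_smul_dir_le i j hδ.le))
  refine ⟨?_, δ, _, hδ, h2, by nlinarith⟩
  rintro rfl
  -- For `i = k` the two steps partly cancel, so the total distance is at most that of the first.
  have hl' : l1 (y + c • dir h i + δ • dir i j - y) ≤ 2 * c := by
    have : y + c • dir h i + δ • dir i j - y = (c - δ) • dir h i + δ • dir h j := by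
      ext l
      simp only [dir, Pi.add_apply, Pi.sub_apply, Pi.smul_apply, smul_eq_mul]
      ring
    rw [this]
    refine (l1_add_le _ _).trans ((add_le_add (l1_smul_dir_le h i (by linarith))
      (l1_smul_dir_le h j hδ.le)).trans_eq (by ring))
  have h3 := hf.le_of_le_dirDeriv hv hs h2
  nlinarith

theorem add_smul_dir_add_smul_dir_apply (y : Fin n → ℝ) (c δ : ℝ) (h k i j l : Fin n) :
    (y + c • dir h k + δ • dir i j) l = y l + c * ((if l = h then 1 else 0)
      - (if l = k then 1 else 0)) + δ * ((if l = i then 1 else 0) - (if l = j then 1 else 0)) := by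
  simp [dir, Pi.single_apply]

/-- An index `i` none of whose directions `(i, j)` attains the slope keeps this property under
steps in steepest descent directions. -/
theorem lt_dirDeriv_of_step (hf : IsPolyhedralMConvex f) {y : Fin n → ℝ} {v s c : ℝ}
    {h k : Fin n} (hs0 : s < 0) (hc : 0 ≤ c) (hv : f y = v)
    (hs : ∀ i j, (s : EReal) ≤ dirDeriv f y i j)
    (hy' : f (y + c • dir h k) = ((v + c * s : ℝ) : EReal)) {i : Fin n}
    (hi : ∀ j, (s : EReal) < dirDeriv f y i j) (j : Fin n) :
    (s : EReal) < dirDeriv f (y + c • dir h k) i j := by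
  have hfc := hf.toIsPolyhedralConvex
  rcases hc.eq_or_lt with rfl | hc
  · simpa using hi j
  refine lt_of_le_of_ne (le_dirDeriv_of_step hf hs0.le hc.le hv hs hy' i j) fun heq => ?_
  have hij : i ≠ j := by
    rintro rfl
    rw [dirDeriv_self hfc (mem_dom_of_le hy'.le)] at heq
    exact hs0.ne (by exact_mod_cast heq)
  -- An exchange that decreases the coordinate `i` of the point reached uses a direction `(i, j')`
  -- of derivative at most `s` at `y`.
  obtain ⟨hik, δ, w, hδ, hw, hle⟩ := exists_tight_of_step hf hs0 hc hv hs hy' heq.symm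
  have hlt : y i < (y + c • dir h k + δ • dir i j) i := by
    rw [add_smul_dir_add_smul_dir_apply, if_neg hik, if_pos rfl, if_neg hij]
    split_ifs <;> linarith
  obtain ⟨j', ε, hex⟩ := hf.exists_exchange hv hw hlt
  exact (hex.dirDeriv_le hf hv hs hle).not_gt (hi j')

/-- While a fixed index `i` is treated, a direction `(i, j)` that does not attain the slope still
does not attain it after a step in another direction `(i, k)`. -/
theorem lt_dirDeriv_of_step_same (hf : IsPolyhedralMConvex f) {y : Fin n → ℝ} {v s c : ℝ}
    {i k : Fin n} (hs0 : s < 0) (hc : 0 ≤ c) (hv : f y = v)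
    (hs : ∀ i j, (s : EReal) ≤ dirDeriv f y i j)
    (hy' : f (y + c • dir i k) = ((v + c * s : ℝ) : EReal)) {j : Fin n}
    (hj : (s : EReal) < dirDeriv f y i j) :
    (s : EReal) < dirDeriv f (y + c • dir i k) i j := by
  have hfc := hf.toIsPolyhedralConvex
  rcases hc.eq_or_lt with rfl | hc
  · simpa using hj
  refine lt_of_le_of_ne (le_dirDeriv_of_step hf hs0.le hc.le hv hs hy' i j) fun heq => ?_
  have hij : j ≠ i := by
    rintro rfl
    rw [dirDeriv_self hfc (mem_dom_of_le hy'.le)] at heq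
    exact hs0.ne (by exact_mod_cast heq)
  obtain ⟨hik, δ, w, hδ, hw, hle⟩ := exists_tight_of_step hf hs0 hc hv hs hy' heq.symm
  have hlt : (y + c • dir i k + δ • dir i j) j < y j := by
    rw [add_smul_dir_add_smul_dir_apply, if_neg hij, if_pos rfl]
    split_ifs <;> linarith
  obtain ⟨i', ε, hex⟩ := hf.exists_exchange' hv hw hlt
  -- Only the coordinate `i` has increased.
  have hi' : i' = i := by
    by_contra hne
    obtain ⟨hε, h1, -⟩ := hex
    rw [add_smul_dir_add_smul_dir_apply, if_neg hne] at h1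
    split_ifs at h1 <;> linarith
  subst hi'
  exact (hex.dirDeriv_le hf hv hs hle).not_gt hj

/-! ### The long step length -/

theorem sub_eq_mul_dirDeriv_iff (hf : IsPolyhedralConvex f) {y : Fin n → ℝ} {v s c : ℝ}
    {i j : Fin n} (hv : f y = v) (hs : dirDeriv f y i j = s) :
    f (y + c • dir i j) - f y = (c : EReal) * dirDeriv f y i j ↔
      f (y + c • dir i j) = ((v + c * s : ℝ) : EReal) := by
  rw [hv, hs, ← EReal.coe_mul]
  constructor
  · intro h
    have hd : f (y + c • dir i j) ≠ ⊤ := by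
      intro ht
      rw [ht, EReal.top_sub_coe] at h
      exact EReal.coe_ne_top _ h.symm
    obtain ⟨u, hu⟩ := exists_real_of_mem_dom hf (mem_dom_of_ne_top hd)
    rw [hu, ← EReal.coe_sub, EReal.coe_eq_coe_iff] at h
    rw [hu, EReal.coe_eq_coe_iff]
    linarith
  · intro h
    rw [h, ← EReal.coe_sub, add_sub_cancel_left]

theorem exists_isStepLength (hf : IsPolyhedralConvex f) (hbdd : Bornology.IsBounded (dom f))
    {y : Fin n → ℝ} {v s : ℝ} {i j : Fin n} (hij : i ≠ j) (hv : f y = v)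
    (hs : dirDeriv f y i j = s) : ∃ c, IsStepLength f y i j c := by
  have hset : {c : ℝ | 0 ≤ c ∧ f (y + c • dir i j) - f y = (c : EReal) * dirDeriv f y i j} =
      Set.Ici 0 ∩ {c : ℝ | f (y + c • dir i j) ≤ ((v + c * s : ℝ) : EReal)} := by
    ext c
    simp only [Set.mem_ofPred_eq, Set.mem_inter_iff, Set.mem_Ici, sub_eq_mul_dirDeriv_iff hf hv hs]
    exact and_congr_right fun hc =>
      ⟨fun h => h.le, fun h => le_antisymm h (le_of_le_dirDeriv hf hv hs.ge hc)⟩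
  unfold IsStepLength
  rw [hset]
  refine IsCompact.exists_isGreatest (Metric.isCompact_of_isClosed_isBounded ?_ ?_)
    ⟨0, le_refl (0 : ℝ), by simp [hv]⟩
  · exact isClosed_Ici.inter (hf.isClosed_le (by fun_prop) (by fun_prop))
  · obtain ⟨R, hR⟩ := hbdd.subset_closedBall y
    refine (Metric.isBounded_closedBall (x := (0 : ℝ)) (r := R)).subset fun c hc => ?_
    have h1 := hR (mem_dom_of_le hc.2)
    rw [Metric.mem_closedBall] at h1 ⊢
    have h2 := (dist_le_pi_dist _ _ i).trans h1
    simpa [dir, Real.dist_eq, Pi.single_apply, hij] using h2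

/-- A long step ends where its direction stops having derivative `s`; otherwise it could be
prolonged. -/
theorem lt_dirDeriv_of_isStepLength (hf : IsPolyhedralConvex f) {y : Fin n → ℝ} {v s c : ℝ}
    {i j : Fin n} (hv : f y = v) (hs : dirDeriv f y i j = s) (hc : IsStepLength f y i j c)
    (hle : (s : EReal) ≤ dirDeriv f (y + c • dir i j) i j) :
    (s : EReal) < dirDeriv f (y + c • dir i j) i j := by
  refine lt_of_le_of_ne hle fun heq => ?_
  have hy' := (sub_eq_mul_dirDeriv_iff hf hv hs).1 hc.1.2
  obtain ⟨δ, hδ, h⟩ := exists_eq_of_dirDeriv_eq hf hy' heq.symm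
  have h1 := h δ hδ.le le_rfl
  rw [add_assoc, ← add_smul] at h1
  have h2 : c + δ ≤ c := hc.2 ⟨by linarith [hc.1.1], (sub_eq_mul_dirDeriv_iff hf hv hs).2 (by
    rw [h1, EReal.coe_eq_coe_iff]
    ring)⟩
  linarith

/-! ### Invariant and potential of the algorithm -/

/-- The state of the slope increasing procedure called at `x`, with current vector `y`, when `P` is
the set of indices not yet finished: no directional derivative at `y` is below the slope at `x`,
and those of a finished index are above it. -/
structure Progress (f : (Fin n → ℝ) → EReal) (x y : Fin n → ℝ) (P : Finset (Fin n)) : Prop where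
  mem_left : x ∈ dom f
  mem_right : y ∈ dom f
  slope_neg : slope f x < 0
  le : ∀ i j, slope f x ≤ dirDeriv f y i j
  lt : ∀ i ∉ P, ∀ j, slope f x < dirDeriv f y i j

/-- The invariant of the algorithm. While `i` is treated, the directions `(i, j)` with `j` not
remaining, among them `(i, i)` with derivative zero, have derivatives above the slope at `x`. -/
def Invariant (f : (Fin n → ℝ) → EReal) : State n → Prop
  | .test x => x ∈ dom f
  | .outer x y P => Progress f x y P
  | .inner x y P i M => Progress f x y P ∧ i ∈ P ∧ i ∉ M ∧
      ∀ j ∉ M, slope f x < dirDeriv f y i j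
  | .output x => x ∈ dom f ∧ slope f x = 0

theorem Progress.slope_lt (hn : 0 < n) {x y : Fin n → ℝ} (h : Progress f x y ∅) :
    slope f x < slope f y := by
  obtain ⟨i, j, hij⟩ := exists_slope_eq (f := f) hn y
  rw [← hij]
  exact h.lt i (Finset.notMem_empty i) j

theorem exists_slope_eq_coe (hn : 0 < n) (hf : IsPolyhedralConvex f) {x : Fin n → ℝ}
    (hx : x ∈ dom f) : ∃ s : ℝ, slope f x = s := by
  obtain ⟨V, hV⟩ := exists_slope_values hn hf
  obtain ⟨s, -, hs⟩ := hV x hx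
  exact ⟨s, hs⟩

theorem Invariant.step (hn : 0 < n) (hf : IsPolyhedralMConvex f) {s t : State n}
    (hs : Invariant f s) (hst : Step f s t) : Invariant f t := by
  have hfc := hf.toIsPolyhedralConvex
  cases hst with
  | finish x h => exact ⟨hs, h⟩
  | call x h =>
    exact ⟨hs, hs, lt_of_le_of_ne (slope_nonpos hn hfc hs) h, slope_le x,
      fun i hi => absurd (Finset.mem_univ i) hi⟩
  | takeOuter x y P i hi =>
    have hP : Progress f x y P := hs
    refine ⟨hP, hi, Finset.notMem_erase i _, fun j hj => ?_⟩
    have hji : j = i := by simpa using hj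
    rw [hji, dirDeriv_self hfc hP.mem_right]
    exact hP.slope_neg
  | move x y P i M j hj h c hc =>
    obtain ⟨hP, hi, hiM, hM⟩ := hs
    obtain ⟨s, hsx⟩ := exists_slope_eq_coe hn hfc hP.mem_left
    obtain ⟨v, hv⟩ := exists_real_of_mem_dom hfc hP.mem_right
    obtain ⟨-, -, hneg, hle, hlt⟩ := id hP
    simp only [hsx] at h hneg hle hlt hM
    have hs0 : s < 0 := by exact_mod_cast hneg
    have hy' := (sub_eq_mul_dirDeriv_iff hfc hv h).1 hc.1.2
    have hle' := le_dirDeriv_of_step hf hs0.le hc.1.1 hv hle hy'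
    refine ⟨⟨hP.mem_left, mem_dom_of_le hy'.le, hP.slope_neg, ?_, ?_⟩, hi,
      fun hmem => hiM (Finset.mem_of_mem_erase hmem), ?_⟩
    · rw [hsx]
      exact hle'
    · rw [hsx]
      exact fun a ha b => lt_dirDeriv_of_step hf hs0 hc.1.1 hv hle hy' (hlt a ha) b
    · rw [hsx]
      intro b hb
      by_cases hbj : b = j
      · rw [hbj]
        exact lt_dirDeriv_of_isStepLength hfc hv h hc (hle' i j)
      · exact lt_dirDeriv_of_step_same hf hs0 hc.1.1 hv hle hy'
          (hM b fun hbM => hb (Finset.mem_erase.2 ⟨hbj, hbM⟩))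
  | skip x y P i M j hj h =>
    obtain ⟨hP, hi, hiM, hM⟩ := hs
    refine ⟨hP, hi, fun hmem => hiM (Finset.mem_of_mem_erase hmem), fun b hb => ?_⟩
    by_cases hbj : b = j
    · rw [hbj]
      exact lt_of_le_of_ne (hP.le i j) h.symm
    · exact hM b fun hbM => hb (Finset.mem_erase.2 ⟨hbj, hbM⟩)
  | closeInner x y P i =>
    obtain ⟨hP, hi, -, hM⟩ := hs
    refine ⟨hP.mem_left, hP.mem_right, hP.slope_neg, hP.le, fun a ha j => ?_⟩
    by_cases hai : a = i
    · rw [hai]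
      exact hM j (Finset.notMem_empty j)
    · exact hP.lt a (fun haP => ha (Finset.mem_erase.2 ⟨hai, haP⟩)) j
  | ret x y => exact Progress.mem_right hs

theorem Invariant.reachable (hn : 0 < n) (hf : IsPolyhedralMConvex f) {s t : State n}
    (hs : Invariant f s) (hst : Relation.ReflTransGen (Step f) s t) : Invariant f t := by
  induction hst with
  | refl => exact hs
  | tail _ h ih => exact ih.step hn hf h

theorem Invariant.exists_step (hn : 0 < n) (hf : IsPolyhedralConvex f)
    (hbdd : Bornology.IsBounded (dom f)) {s : State n} (hs : Invariant f s) :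
    (∃ t, Step f s t) ∨ ∃ x, s = .output x := by
  cases s with
  | test x =>
    by_cases h : slope f x = 0
    · exact Or.inl ⟨_, .finish x h⟩
    · exact Or.inl ⟨_, .call x h⟩
  | outer x y P =>
    rcases P.eq_empty_or_nonempty with rfl | ⟨i, hi⟩
    · exact Or.inl ⟨_, .ret x y⟩
    · exact Or.inl ⟨_, .takeOuter x y P i hi⟩
  | inner x y P i M =>
    obtain ⟨hP, hi, hiM, -⟩ := hs
    rcases M.eq_empty_or_nonempty with rfl | ⟨j, hj⟩
    · exact Or.inl ⟨_, .closeInner x y P i⟩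
    · by_cases h : dirDeriv f y i j = slope f x
      · obtain ⟨s, hsx⟩ := exists_slope_eq_coe hn hf hP.mem_left
        obtain ⟨v, hv⟩ := exists_real_of_mem_dom hf hP.mem_right
        obtain ⟨c, hc⟩ := exists_isStepLength hf hbdd (fun hij : i = j => hiM (hij ▸ hj)) hv
          (h.trans hsx)
        exact Or.inl ⟨_, .move x y P i M j hj h c hc⟩
      · exact Or.inl ⟨_, .skip x y P i M j hj h⟩
  | output x => exact Or.inr ⟨x, rfl⟩

open Classical in
/-- The number of elements of `V` above the slope at `x`. -/
def rank (f : (Fin n → ℝ) → EReal) (V : Finset ℝ) (x : Fin n → ℝ) : ℕ :=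
  (V.filter fun s : ℝ => slope f x < (s : EReal)).card

theorem rank_lt_rank {V : Finset ℝ} {x y : Fin n → ℝ} (hy : ∃ s ∈ V, slope f y = (s : EReal))
    (h : slope f x < slope f y) : rank f V y < rank f V x := by
  obtain ⟨s, hs, hsy⟩ := hy
  refine Finset.card_lt_card ((Finset.ssubset_iff_of_subset fun a ha => ?_).2 ⟨s, ?_, ?_⟩)
  · rw [Finset.mem_filter] at ha ⊢
    exact ⟨ha.1, h.trans ha.2⟩
  · exact Finset.mem_filter.2 ⟨hs, hsy ▸ h⟩
  · simp [hsy]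

/-- A bound for the number of remaining elementary steps: a call of the slope increasing procedure
takes fewer than `n * (n + 2) + 2` of them and decreases `rank f V`. -/
def potential (f : (Fin n → ℝ) → EReal) (V : Finset ℝ) : State n → ℕ
  | .test x => (rank f V x + 1) * (n * (n + 2) + 2) + 1
  | .outer x _ P => rank f V x * (n * (n + 2) + 2) + P.card * (n + 2) + 2
  | .inner x _ P i M => rank f V x * (n * (n + 2) + 2) + (P.erase i).card * (n + 2) + M.card + 3
  | .output _ => 0

theorem potential_lt (hn : 0 < n) {V : Finset ℝ}
    (hV : ∀ x ∈ dom f, ∃ s ∈ V, slope f x = (s : EReal)) {s t : State n} (hs : Invariant f s)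
    (hst : Step f s t) : potential f V t < potential f V s := by
  cases hst with
  | finish x h => exact Nat.succ_pos _
  | call x h =>
    simp only [potential, Finset.card_univ, Fintype.card_fin, add_mul, one_mul]
    omega
  | takeOuter x y P i hi =>
    simp only [potential, Finset.card_erase_of_mem (Finset.mem_univ i), Finset.card_univ,
      Fintype.card_fin]
    rw [← Finset.card_erase_add_one hi, add_mul (P.erase i).card]
    omega
  | move x y P i M j hj h c hc =>
    simp only [potential]
    have := Finset.card_erase_lt_of_mem hj
    omega
  | skip x y P i M j hj h =>
    simp only [potential]
    have := Finset.card_erase_lt_of_mem hj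
    omega
  | closeInner x y P i =>
    simp only [potential, Finset.card_empty]
    omega
  | ret x y =>
    have hP : Progress f x y ∅ := hs
    have h := Nat.mul_le_mul_right (n * (n + 2) + 2)
      (Nat.succ_le_of_lt (rank_lt_rank (hV y hP.mem_right) (hP.slope_lt hn)))
    simp only [potential, Finset.card_empty, zero_mul, add_zero]
    rw [Nat.succ_eq_add_one] at h
    omega

theorem isMin_of_slope_eq_zero (hf : IsPolyhedralMConvex f) {x : Fin n → ℝ} (hx : x ∈ dom f)
    (h : slope f x = 0) (y : Fin n → ℝ) : f x ≤ f y := by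
  by_cases hy : f y = ⊤
  · rw [hy]
    exact le_top
  have hfc := hf.toIsPolyhedralConvex
  obtain ⟨v, hv⟩ := exists_real_of_mem_dom hfc hx
  obtain ⟨w, hw⟩ := exists_real_of_mem_dom hfc (mem_dom_of_ne_top hy)
  have h1 := hf.le_of_le_dirDeriv (s := 0) hv (fun i j => by
    rw [EReal.coe_zero, ← h]
    exact slope_le x i j) hw
  rw [hv, hw, EReal.coe_le_coe_iff]
  linarith

end PolyM

end

theorem mainTheorem3 (n : ℕ) (hn : 0 < n) (f : (Fin n → ℝ) → EReal)
    (hf : PolyM.IsPolyhedralMConvex f) (hbdd : Bornology.IsBounded (PolyM.dom f))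
    (x₀ : Fin n → ℝ) (hx₀ : x₀ ∈ PolyM.dom f) :
    (∃ K : ℕ, ∀ (m : ℕ) (s : ℕ → PolyM.State n), s 0 = PolyM.State.test x₀ →
        (∀ k < m, PolyM.Step f (s k) (s (k + 1))) → m ≤ K) ∧
    (∀ s : PolyM.State n, Relation.ReflTransGen (PolyM.Step f) (PolyM.State.test x₀) s →
        (∃ t, PolyM.Step f s t) ∨ ∃ x, s = PolyM.State.output x) ∧
    (∀ x : Fin n → ℝ,
        Relation.ReflTransGen (PolyM.Step f) (PolyM.State.test x₀) (PolyM.State.output x) →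
        x ∈ PolyM.dom f ∧ ∀ y, f x ≤ f y) := by
  have hfc := hf.toIsPolyhedralConvex
  have h₀ : PolyM.Invariant f (.test x₀) := hx₀
  refine ⟨?_, fun s hs => (h₀.reachable hn hf hs).exists_step hn hfc hbdd, fun x hx => ?_⟩
  · obtain ⟨V, hV⟩ := PolyM.exists_slope_values hn hfc
    refine ⟨PolyM.potential f V (.test x₀), fun m s hs0 hs => ?_⟩
    have key : ∀ k ≤ m, PolyM.Invariant f (s k) ∧
        PolyM.potential f V (s k) + k ≤ PolyM.potential f V (.test x₀) := by
      intro k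
      induction k with
      | zero => exact fun _ => by rw [hs0]; exact ⟨h₀, le_rfl⟩
      | succ k ih =>
        intro hk
        obtain ⟨h1, h2⟩ := ih (Nat.le_of_succ_le hk)
        have h3 := PolyM.potential_lt hn hV h1 (hs k hk)
        exact ⟨h1.step hn hf (hs k hk), by omega⟩
    have := (key m le_rfl).2
    omega
  · obtain ⟨h1, h2⟩ := h₀.reachable hn hf hx
    exact ⟨h1, PolyM.isMin_of_slope_eq_zero hf h1 h2⟩
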